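/- Let $n\ge 0$ and $1\le k\le n+1$ be integers, and let $S=\{x\in\mathbb R^{n+1} : \sum_{j=1}^{n+1}x_j=1,\ x_j\ge 0 \text{ for all } j\}$ be the regular $n$-simplex. Let $H$ be a $k$-dimensional linear subspace of $\mathbb R^{n+1}$ that is not contained in any of the coordinate hyperplanes $\{x_j=0\}$, $j=1,\dots,n+1$, and let $a^1,\dots,a^{n+1-k}$ be an orthonormal basis of $H^\perp$. Then the function $s\mapsto \prod_{j=1}^{n+1}\bigl(1+\mathrm i\sum_{l=1}^{n+1-k}a^l_j s^l\bigr)^{-1}$ is Lebesgue integrable on $\mathbb R^{n+1-k}$, the $(k-1)$-dimensional volume $\mathrm{vol}_{k-1}(H\cap S)$ is finite, and $$\mathrm{vol}_{k-1}(H\cap S)=\frac{\sqrt{\,n+1-\sum_{l=1}^{n+1-k}\bigl(\sum_{j=1}^{n+1}a^l_j\bigr)^2}}{(k-1)!}\;\frac{1}{(2\pi)^{n+1-k}}\int_{\mathbb R^{n+1-k}}\prod_{j=1}^{n+1}\frac{1}{1+\mathrm i\sum_{l=1}^{n+1-k}a^l_j s^l}\,\mathrm ds .$$ Here $\mathrm{vol}_{k-1}$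 is the Lebesgue measure induced on $(k-1)$-dimensional affine subspaces (counting measure if $k=1$), and for $k=n+1$ the integral over $\mathbb R^0$ is the value of the integrand at its only point, namely $1$. -/

import Mathlib

open MeasureTheory

/-- The regular `n`-simplex with `n + 1` vertices (the standard basis vectors), of side length `√2`,
embedded in Euclidean space `ℝ^(n+1)`. -/
def regularSimplex (n : ℕ) : Set (EuclideanSpace ℝ (Fin (n + 1))) :=
  {x | ∑ j, x j = 1 ∧ ∀ j, 0 ≤ x j}

/-- The integrand `s ↦ ∏ j, 1 / (1 + i ∑ l, a^l_j s^l)` attached to vectors `a^1, …, a^m` of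
`ℝ^(n+1)`. -/
noncomputable def sectionIntegrand {n m : ℕ} (a : Fin m → EuclideanSpace ℝ (Fin (n + 1)))
    (s : EuclideanSpace ℝ (Fin m)) : ℂ :=
  ∏ j : Fin (n + 1), 1 / (1 + Complex.I * ((∑ l : Fin m, a l j * s l : ℝ) : ℂ))

/-! Integrate f(x) = exp(-∑ x_j), restricted to the nonnegative orthant, over H in two ways. Write N
= n + 1 and m = N - k.

Fourier side: let G(y) be the integral of f over H + y, for y in Hᗮ. By Fubini the transform of G is
that of f restricted to Hᗮ, a product of one-dimensional integrals 1 / (1 + i z_j)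
(`fourier_sliceIntegral`). G is integrable and continuous at 0, so once the product is integrable,
Fourier inversion at 0 gives G(0) = (2π)^(-m) ∫ ∏ (`sliceIntegral_zero_eq`).

Geometric side: layering by the coordinate sum and using homogeneity, G(0) = k! vol{h ∈ H : h ≥ 0, ∑
h_j ≤ 1}. Slicing this cone orthogonally to q, the projection of (1, …, 1) to H, turns it into
(k-1)! / ‖q‖ times the volume of the section (`lintegral_expOrthant_eq`). Pythagoras identifies ‖q‖
with the square root in the formula.

Integrability is the delicate point, since |1 + it|⁻¹ is not integrable on ℝ. As H lies in no
coordinate hyperplane, any N - 1 coordinates still separate the points of Hᗮ. For each i there is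
thus a coordinate system avoiding i, and the geometric mean of these N systems leaves room for an
exponent above 1 (`integrable_prod_rpow_of_separating`). -/

/-! ### Integrability of products of reciprocal linear factors. -/

section Integrability

variable {V : Type*} [NormedAddCommGroup V] [InnerProductSpace ℝ V] [FiniteDimensional ℝ V]

/-- From a family of functionals without common zero one can extract linear coordinates. -/
theorem exists_coordinates_of_separating {ι : Type*} [Fintype ι] (ℓ : ι → Module.Dual ℝ V)
    (hℓ : ∀ s, (∀ j, ℓ j s = 0) → s = 0) :
    ∃ (B : Finset ι) (L : V ≃L[ℝ] (B → ℝ)), (∀ j ∈ B, ℓ j ≠ 0) ∧ ∀ s j, L s j = ℓ j s := by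
  classical
  obtain ⟨κ, c, hc, hspan, hli⟩ := exists_linearIndependent' ℝ ℓ
  have : Finite κ := Finite.of_injective c hc
  have : Fintype κ := Fintype.ofFinite κ
  let B : Finset ι := Finset.univ.image c
  have hB : Fintype.card B = Fintype.card κ := by
    rw [Fintype.card_coe, Finset.card_image_of_injective _ hc, Finset.card_univ]
  let L₀ : V →ₗ[ℝ] (B → ℝ) := LinearMap.pi fun j => ℓ j
  have hinj : Function.Injective L₀ := by
    rw [← LinearMap.ker_eq_bot, LinearMap.ker_eq_bot']
    intro s hs
    refine hℓ s fun j => ?_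
    have hj : ℓ j ∈ Submodule.span ℝ (Set.range (ℓ ∘ c)) :=
      hspan ▸ Submodule.subset_span ⟨j, rfl⟩
    refine Submodule.span_induction (p := fun φ _ => φ s = 0) ?_ ?_ ?_ ?_ hj
    · rintro _ ⟨k, rfl⟩
      exact congrFun hs ⟨c k, by simp [B]⟩
    · simp
    · intro x y _ _ hx hy
      simp [hx, hy]
    · intro r x _ hx
      simp [hx]
  have hle : Module.finrank ℝ V ≤ Module.finrank ℝ (B → ℝ) :=
    LinearMap.finrank_le_finrank_of_injective hinj
  -- The selected functionals are independent in the dual, so there are at most dim V of them.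
  have hge : Module.finrank ℝ (B → ℝ) ≤ Module.finrank ℝ V := by
    rw [Module.finrank_fintype_fun_eq_card, hB, ← Subspace.dual_finrank_eq (K := ℝ) (V := V)]
    exact hli.fintype_card_le_finrank
  refine ⟨B, (LinearEquiv.ofInjectiveOfFinrankEq L₀ hinj
    (le_antisymm hle hge)).toContinuousLinearEquiv, fun j hj => ?_, fun s j => rfl⟩
  obtain ⟨k, -, rfl⟩ := Finset.mem_image.1 hj
  exact hli.ne_zero k

variable [MeasurableSpace V] [BorelSpace V]

/-- A product of integrable functions of linear coordinates is integrable. -/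
theorem integrable_prod_comp_linearEquiv {κ : Type*} [Fintype κ] (L : V ≃L[ℝ] (κ → ℝ))
    (g : ℝ → ℝ) (hg : Integrable g) : Integrable (fun s : V => ∏ k, g (L s k)) := by
  have h1 : Integrable (fun y : κ → ℝ => ∏ k, g (y k)) :=
    Integrable.fintype_prod (fun _ => hg)
  have h2 : Integrable (fun y : κ → ℝ => ∏ k, g (y k)) (Measure.map L volume) := by
    -- Uniqueness of Haar measure: the Jacobian of `L` is an unspecified finite constant.
    rw [Measure.isAddLeftInvariant_eq_smul (Measure.map L volume) volume]
    exact h1.smul_measure ENNReal.coe_ne_top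
  exact (L.toHomeomorph.measurableEmbedding.integrable_map_iff).1 h2

/-- If the coordinates of `A` separate points even after deleting any one of them, then
`s ↦ ∏ j, (1 + (A s)_j²)^(-1/2)` is integrable: it is dominated by an average of products over
coordinate systems of `V`, one avoiding each coordinate of `A`. -/
theorem integrable_prod_rpow_of_separating {N : ℕ} (hN : 0 < N) (A : V →ₗ[ℝ] (Fin N → ℝ))
    (hA : ∀ i s, (∀ j, j ≠ i → A s j = 0) → s = 0) :
    Integrable (fun s : V => ∏ j, (1 + A s j ^ 2) ^ (-(1 / 2) : ℝ)) := by
  classical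
  have key : ∀ i : Fin N, ∃ (B : Finset (Fin N)) (L : V ≃L[ℝ] (B → ℝ)), i ∉ B ∧
      ∀ s j, L s j = A s j := by
    intro i
    -- The i-th functional is replaced by 0; selected functionals are nonzero, so i is never
    -- selected.
    obtain ⟨B, L, hB, hL⟩ := exists_coordinates_of_separating
      (fun j => if j = i then 0 else (LinearMap.proj j).comp A)
      (fun s hs => hA i s fun j hj => by simpa [hj] using hs j)
    have hi : i ∉ B := fun h => hB i h (if_pos rfl)
    refine ⟨B, L, hi, fun s j => ?_⟩
    have hj : (j : Fin N) ≠ i := fun h => hi (h ▸ j.2)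
    rw [hL, if_neg hj]
    rfl
  choose B L hiB hL using key
  -- q > 1 makes each (1 + t²)^(-q/2) integrable. Each j lies in at most N - 1 of the sets `B i`, so
  -- its exponent in the geometric mean is at most (N - 1) q / (2N) = (N² - 1) / (2N²) < 1/2 in
  -- size.
  set q : ℝ := (N + 1) / N with hq
  have hN' : (0 : ℝ) < N := by exact_mod_cast hN
  have hq1 : 1 < q := by rw [hq, lt_div_iff₀ hN']; linarith
  have hg : Integrable (fun t : ℝ => (1 + t ^ 2) ^ (-q / 2)) := by
    have := integrable_rpow_neg_one_add_norm_sq (E := ℝ) (μ := volume) (r := q) (by simpa using hq1)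
    simpa using this
  have hdom : Integrable (fun s : V =>
      ∑ i, (1 / N : ℝ) * ∏ j : B i, (1 + (L i s j) ^ 2) ^ (-q / 2)) := by
    refine integrable_finsetSum _ fun i _ => Integrable.const_mul ?_ _
    exact integrable_prod_comp_linearEquiv (L i) _ hg
  have hAc : Continuous A := A.continuous_of_finiteDimensional
  refine hdom.mono' ?_ (Filter.Eventually.of_forall fun s => ?_)
  · refine Continuous.aestronglyMeasurable ?_
    refine continuous_finsetProd _ fun j _ => ?_
    refine Continuous.rpow_const (by fun_prop) fun s => Or.inl (by positivity)
  have hpos : ∀ j, 0 < 1 + A s j ^ 2 := fun j => by positivity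
  rw [Real.norm_of_nonneg (Finset.prod_nonneg fun j _ => (Real.rpow_pos_of_pos (hpos j) _).le)]
  have hz : ∀ i, (∏ j : B i, (1 + (L i s j) ^ 2) ^ (-q / 2)) =
      ∏ j, if j ∈ B i then (1 + A s j ^ 2) ^ (-q / 2) else 1 := by
    intro i
    simp_rw [hL]
    rw [Finset.prod_coe_sort (B i) (fun j => (1 + A s j ^ 2) ^ (-q / 2)), Finset.prod_ite_mem,
      Finset.univ_inter]
  have amgm := Real.geom_mean_le_arith_mean_weighted (Finset.univ : Finset (Fin N))
    (fun _ => (1 / N : ℝ)) (fun i => ∏ j : B i, (1 + (L i s j) ^ 2) ^ (-q / 2))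
    (fun _ _ => by positivity) (by simp [hN'.ne'])
    (fun i _ => Finset.prod_nonneg fun j _ => by positivity)
  refine le_trans ?_ amgm
  have hterm : ∀ i, (∏ j : B i, (1 + (L i s j) ^ 2) ^ (-q / 2)) ^ (1 / N : ℝ) =
      ∏ j, if j ∈ B i then (1 + A s j ^ 2) ^ (-q / 2 * (1 / N)) else 1 := by
    intro i
    rw [hz, ← Real.finsetProd_rpow _ _ (fun j _ => by have := hpos j; split_ifs <;> positivity)]
    refine Finset.prod_congr rfl fun j _ => ?_
    split_ifs
    · rw [← Real.rpow_mul (hpos j).le]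
    · simp
  simp_rw [hterm]
  rw [Finset.prod_comm]
  refine Finset.prod_le_prod (fun j _ => (Real.rpow_pos_of_pos (hpos j) _).le) fun j _ => ?_
  have h1 : 1 ≤ 1 + A s j ^ 2 := by nlinarith [sq_nonneg (A s j)]
  set y : ℝ := (1 + A s j ^ 2) ^ (-q / 2 * (1 / N)) with hy
  have hy0 : 0 ≤ y := (Real.rpow_pos_of_pos (hpos j) _).le
  have hy1 : y ≤ 1 := by
    refine Real.rpow_le_one_of_one_le_of_nonpos h1 ?_
    have : 0 ≤ q / 2 * (1 / N) := by positivity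
    linarith [show -q / 2 * (1 / N : ℝ) = -(q / 2 * (1 / N)) by ring]
  -- The worst case is j ∈ `B i` for all i ≠ j, because y ≤ 1.
  have hstep : (∏ i : Fin N, if i = j then (1 : ℝ) else y) ≤
      ∏ i : Fin N, if j ∈ B i then y else 1 := by
    refine Finset.prod_le_prod (fun i _ => by split_ifs <;> positivity) fun i _ => ?_
    by_cases hij : i = j
    · subst hij
      simp [hiB]
    · rw [if_neg hij]
      split_ifs <;> linarith
  refine le_trans ?_ hstep
  rw [Finset.prod_ite, Finset.prod_const_one, one_mul, Finset.prod_const, Finset.filter_ne',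
    Finset.card_erase_of_mem (Finset.mem_univ _), Finset.card_univ, Fintype.card_fin, hy,
    ← Real.rpow_mul_natCast (hpos j).le]
  refine Real.rpow_le_rpow_of_exponent_le h1 ?_
  rw [Nat.cast_sub hN, hq]
  field_simp
  push_cast
  nlinarith

/-- Integrability of `s ↦ ∏ j, 1 / (1 + i (A s)_j)`. -/
theorem integrable_prod_one_div_one_add_I_mul {N : ℕ} (hN : 0 < N) (A : V →ₗ[ℝ] (Fin N → ℝ))
    (hA : ∀ i s, (∀ j, j ≠ i → A s j = 0) → s = 0) :
    Integrable (fun s : V => ∏ j, 1 / (1 + Complex.I * (A s j : ℂ))) := by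
  have hAc : Continuous A := A.continuous_of_finiteDimensional
  have hne : ∀ t : ℝ, (1 + Complex.I * (t : ℂ)) ≠ 0 := fun t h => by
    simpa using congrArg Complex.re h
  refine (integrable_prod_rpow_of_separating hN A hA).mono' ?_
    (Filter.Eventually.of_forall fun s => ?_)
  · refine Continuous.aestronglyMeasurable ?_
    refine continuous_finsetProd _ fun j _ => ?_
    exact continuous_const.div (by fun_prop) fun s => hne _
  · rw [norm_prod]
    refine Finset.prod_le_prod (fun _ _ => norm_nonneg _) fun j _ => le_of_eq ?_
    rw [norm_div, norm_one, mul_comm, ← Complex.ofReal_one, Complex.norm_add_mul_I,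
      Real.rpow_neg (by positivity), ← Real.sqrt_eq_rpow]
    simp

end Integrability

/-! ### The exponential on the orthant and its Fourier transform. -/

section ExpOrthant

/-- The function `x ↦ exp (-∑ j, x j)` on the nonnegative orthant, extended by zero. -/
noncomputable def expOrthant {N : ℕ} (x : EuclideanSpace ℝ (Fin N)) : ℝ :=
  ∏ j, (Set.Ici (0 : ℝ)).indicator (fun t => Real.exp (-t)) (x j)

theorem expOrthant_eq_ite {N : ℕ} (x : EuclideanSpace ℝ (Fin N)) [Decidable (∀ j, 0 ≤ x j)] :
    expOrthant x = if ∀ j, 0 ≤ x j then Real.exp (-∑ j, x j) else 0 := by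
  unfold expOrthant
  split_ifs with h
  · rw [← Finset.sum_neg_distrib, Real.exp_sum]
    exact Finset.prod_congr rfl fun j _ => Set.indicator_of_mem (h j) _
  · push Not at h
    obtain ⟨j, hj⟩ := h
    exact Finset.prod_eq_zero (Finset.mem_univ j) (Set.indicator_of_notMem (by simpa using hj) _)

theorem expOrthant_nonneg {N : ℕ} (x : EuclideanSpace ℝ (Fin N)) : 0 ≤ expOrthant x :=
  Finset.prod_nonneg fun _ _ => Set.indicator_nonneg (fun _ _ => (Real.exp_pos _).le) _

theorem measurable_expOrthant {N : ℕ} :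
    Measurable (expOrthant : EuclideanSpace ℝ (Fin N) → ℝ) := by
  unfold expOrthant
  refine Finset.measurable_prod _ fun j _ => ?_
  have h : Measurable ((Set.Ici (0 : ℝ)).indicator (fun t => Real.exp (-t))) :=
    (by fun_prop : Measurable fun t : ℝ => Real.exp (-t)).indicator measurableSet_Ici
  exact h.comp (by fun_prop)

/-- The decaying exponential on the half line. -/
theorem integrable_indicator_exp_neg :
    Integrable ((Set.Ici (0 : ℝ)).indicator (fun t => Real.exp (-t))) := by
  rw [integrable_indicator_iff measurableSet_Ici, integrableOn_Ici_iff_integrableOn_Ioi]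
  exact integrableOn_exp_neg_Ioi 0

theorem integrable_expOrthant {N : ℕ} :
    Integrable (expOrthant : EuclideanSpace ℝ (Fin N) → ℝ) := by
  have h : Integrable (fun x : Fin N → ℝ =>
      ∏ j, (Set.Ici (0 : ℝ)).indicator (fun t => Real.exp (-t)) (x j)) :=
    Integrable.fintype_prod fun _ => integrable_indicator_exp_neg
  exact ((EuclideanSpace.volume_preserving_symm_measurableEquiv_toLp (Fin N)).integrable_comp_emb
    (MeasurableEquiv.measurableEmbedding _)).2 h

/-- The one-dimensional Laplace-Fourier integral. -/
theorem integral_cexp_mul_indicator_exp_neg (z : ℝ) :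
    ∫ t : ℝ, Complex.exp (-(z * t : ℝ) * Complex.I) *
      ((Set.Ici (0 : ℝ)).indicator (fun t => Real.exp (-t)) t : ℝ) =
        1 / (1 + Complex.I * (z : ℂ)) := by
  have h1 : ∀ t : ℝ, Complex.exp (-(z * t : ℝ) * Complex.I) *
      ((Set.Ici (0 : ℝ)).indicator (fun t => Real.exp (-t)) t : ℝ) =
      (Set.Ici (0 : ℝ)).indicator
        (fun t : ℝ => Complex.exp (-(1 + Complex.I * (z : ℂ)) * t)) t := by
    intro t
    by_cases ht : t ∈ Set.Ici (0 : ℝ)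
    · rw [Set.indicator_of_mem ht, Set.indicator_of_mem ht, Complex.ofReal_exp, ← Complex.exp_add]
      congr 1
      push_cast
      ring
    · rw [Set.indicator_of_notMem ht, Set.indicator_of_notMem ht]
      simp
  simp_rw [h1]
  rw [integral_indicator measurableSet_Ici, integral_Ici_eq_integral_Ioi,
    integral_exp_mul_complex_Ioi (by simp)]
  rw [Complex.ofReal_zero, mul_zero, Complex.exp_zero, neg_div_neg_eq]

/-- The Fourier transform of `expOrthant`. -/
theorem integral_cexp_mul_expOrthant {N : ℕ} (z : Fin N → ℝ) :
    ∫ x : EuclideanSpace ℝ (Fin N), Complex.exp (-(∑ j, z j * x j : ℝ) * Complex.I) *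
      (expOrthant x : ℂ) = ∏ j, 1 / (1 + Complex.I * (z j : ℂ)) := by
  rw [← (PiLp.volume_preserving_toLp (Fin N)).integral_comp
    (MeasurableEquiv.measurableEmbedding (MeasurableEquiv.toLp 2 (Fin N → ℝ)))]
  simp_rw [← integral_cexp_mul_indicator_exp_neg]
  rw [← integral_fintype_prod_volume_eq_prod]
  congr 1
  ext x
  rw [Finset.prod_mul_distrib, expOrthant, ← Complex.exp_sum]
  push_cast
  congr 2
  rw [← Finset.sum_neg_distrib, Finset.sum_mul]

/-- A locally uniform bound for translates of the exponential on the half line. -/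
theorem indicator_exp_neg_add_le {h y : ℝ} (hy : |y| ≤ 1) :
    (Set.Ici (0 : ℝ)).indicator (fun t => Real.exp (-t)) (h + y) ≤
      2 * Real.exp 3 * (1 + h ^ 2)⁻¹ := by
  by_cases ht : h + y ∈ Set.Ici (0 : ℝ)
  · rw [Set.indicator_of_mem ht]
    have hy' := abs_le.1 hy
    have hh : 0 ≤ h + y := ht
    -- Here h ≥ -y ≥ -1. The constant exp 3 collects this 2 and the bound -y ≤ 1.
    have h1 : |h| ≤ h + 2 := abs_le.2 ⟨by linarith, by linarith⟩
    have h2 : Real.exp (-(h + y)) ≤ Real.exp 3 * Real.exp (-|h|) := by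
      rw [← Real.exp_add]
      exact Real.exp_le_exp.2 (by linarith)
    have h3 : (1 + h ^ 2) / 2 ≤ Real.exp |h| := by
      have := Real.quadratic_le_exp_of_nonneg (abs_nonneg h)
      rw [sq_abs] at this
      linarith [abs_nonneg h]
    have h4 : Real.exp (-|h|) ≤ 2 * (1 + h ^ 2)⁻¹ := by
      rw [Real.exp_neg, show 2 * (1 + h ^ 2)⁻¹ = ((1 + h ^ 2) / 2)⁻¹ by rw [inv_div]; rfl]
      exact inv_anti₀ (by positivity) h3
    calc _ ≤ Real.exp 3 * Real.exp (-|h|) := h2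
      _ ≤ Real.exp 3 * (2 * (1 + h ^ 2)⁻¹) := by gcongr
      _ = _ := by ring
  · rw [Set.indicator_of_notMem ht]
    positivity

end ExpOrthant

/-! ### Slices parallel to H and Fourier inversion. -/

section Slices

variable {N : ℕ} (H : Submodule ℝ (EuclideanSpace ℝ (Fin N)))

/-- A bound, integrable on `H`, for all small translates of `expOrthant`. -/
theorem exists_integrable_bound_expOrthant_add :
    ∃ g : H → ℝ, Integrable g ∧ ∀ (h : H) (y : EuclideanSpace ℝ (Fin N)), ‖y‖ ≤ 1 →
      expOrthant ((h : EuclideanSpace ℝ (Fin N)) + y) ≤ g h := by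
  classical
  let ℓ : Fin N → Module.Dual ℝ H := fun j =>
    (EuclideanSpace.proj j : EuclideanSpace ℝ (Fin N) →L[ℝ] ℝ).toLinearMap.comp H.subtype
  obtain ⟨B, L, -, hL⟩ := exists_coordinates_of_separating ℓ (fun s hs => by
    ext j
    exact hs j)
  refine ⟨fun h => (2 * Real.exp 3) ^ N * ∏ k, (1 + (L h k) ^ 2)⁻¹,
    (integrable_prod_comp_linearEquiv L _ integrable_inv_one_add_sq).const_mul _,
    fun h y hy => ?_⟩
  have hB : ∏ k, (1 + (L h k) ^ 2)⁻¹ =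
      ∏ j, if j ∈ B then (1 + (h : EuclideanSpace ℝ (Fin N)) j ^ 2)⁻¹ else 1 := by
    simp_rw [hL]
    rw [Finset.prod_coe_sort B (fun j => (1 + (ℓ j h) ^ 2)⁻¹), Finset.prod_ite_mem,
      Finset.univ_inter]
    rfl
  refine le_trans ?_ (mul_le_mul_of_nonneg_left hB.ge (by positivity))
  calc expOrthant ((h : EuclideanSpace ℝ (Fin N)) + y)
      ≤ ∏ j, 2 * Real.exp 3 * (1 + (h : EuclideanSpace ℝ (Fin N)) j ^ 2)⁻¹ :=
        Finset.prod_le_prod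
          (fun _ _ => Set.indicator_nonneg (fun _ _ => (Real.exp_pos _).le) _)
          fun j _ => indicator_exp_neg_add_le ((PiLp.norm_apply_le y j).trans hy)
    _ = (2 * Real.exp 3) ^ N * ∏ j, (1 + (h : EuclideanSpace ℝ (Fin N)) j ^ 2)⁻¹ := by
        rw [Finset.prod_mul_distrib, Finset.prod_const, Finset.card_univ, Fintype.card_fin]
    -- Only the factors in `B`, which are coordinates of H, are kept; the others are at most 1.
    _ ≤ _ := by
        refine mul_le_mul_of_nonneg_left ?_ (by positivity)
        refine Finset.prod_le_prod (fun _ _ => by positivity) fun j _ => ?_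
        split_ifs
        · exact le_rfl
        · exact inv_le_one_of_one_le₀ (by nlinarith [sq_nonneg ((h : EuclideanSpace ℝ (Fin N)) j)])

/-- If no coordinate vanishes identically on `H`, almost every point of `H` has nonzero
coordinates. -/
theorem ae_forall_coord_ne_zero (hcoord : ∀ j, ∃ x ∈ H, x j ≠ 0) :
    ∀ᵐ h : H, ∀ j, (h : EuclideanSpace ℝ (Fin N)) j ≠ 0 := by
  rw [ae_all_iff]
  intro j
  let ℓ : Module.Dual ℝ H :=
    (EuclideanSpace.proj j : EuclideanSpace ℝ (Fin N) →L[ℝ] ℝ).toLinearMap.comp H.subtype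
  have h0 : volume (LinearMap.ker ℓ : Set H) = 0 := by
    refine Measure.addHaar_submodule volume _ fun htop => ?_
    obtain ⟨x, hx, hxj⟩ := hcoord j
    have : (⟨x, hx⟩ : H) ∈ LinearMap.ker ℓ := htop ▸ Submodule.mem_top
    exact hxj this
  exact measure_mono_null (fun h hh => not_not.1 hh) h0

/-- `expOrthant` is continuous at every point without vanishing coordinates. -/
theorem continuousAt_expOrthant {x : EuclideanSpace ℝ (Fin N)} (hx : ∀ j, x j ≠ 0) :
    ContinuousAt expOrthant x := by
  unfold expOrthant
  refine tendsto_finsetProd _ fun j _ => ?_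
  have hc : ContinuousAt ((Set.Ici (0 : ℝ)).indicator (fun t => Real.exp (-t))) (x j) := by
    have hf : Continuous fun t : ℝ => Real.exp (-t) := by fun_prop
    refine hf.continuousOn.continuousAt_indicator ?_
    rw [frontier_Ici]
    exact hx j
  exact hc.tendsto.comp (by fun_prop : Continuous fun x : EuclideanSpace ℝ (Fin N) => x j).continuousAt

variable {m : ℕ} (a : OrthonormalBasis (Fin m) ℝ Hᗮ)

/-- The decomposition of space along `H` and the coordinates given by a basis of `Hᗮ`. -/
noncomputable def sliceEquiv : H × EuclideanSpace ℝ (Fin m) ≃ᵐ EuclideanSpace ℝ (Fin N) :=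
  ((MeasurableEquiv.refl H).prodCongr a.measurableEquiv.symm).trans
    ((MeasurableEquiv.toLp 2 (H × Hᗮ)).trans H.orthogonalDecomposition.symm.toMeasurableEquiv)

theorem sliceEquiv_apply (p : H × EuclideanSpace ℝ (Fin m)) :
    sliceEquiv H a p = (p.1 : EuclideanSpace ℝ (Fin N)) +
      (a.repr.symm p.2 : EuclideanSpace ℝ (Fin N)) := by
  simp [sliceEquiv, OrthonormalBasis.measurableEquiv, MeasurableEquiv.prodCongr]

theorem measurePreserving_sliceEquiv : MeasurePreserving (sliceEquiv H a) := by
  refine ((MeasurePreserving.id volume).prod a.measurePreserving_repr_symm).trans ?_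
  exact (WithLp.volume_preserving_toLp H Hᗮ).trans
    H.orthogonalDecomposition.symm.measurePreserving

/-- The integral of `expOrthant` over the slice through `y` parallel to `H`. -/
noncomputable def sliceIntegral (y : EuclideanSpace ℝ (Fin m)) : ℂ :=
  ∫ h : H, (expOrthant ((h : EuclideanSpace ℝ (Fin N)) +
    (a.repr.symm y : EuclideanSpace ℝ (Fin N))) : ℂ)

theorem integrable_expOrthant_sliceEquiv :
    Integrable (fun p : H × EuclideanSpace ℝ (Fin m) => (expOrthant (sliceEquiv H a p) : ℂ)) :=
  ((measurePreserving_sliceEquiv H a).integrable_comp_emb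
    (sliceEquiv H a).measurableEmbedding).2 integrable_expOrthant.ofReal

theorem integrable_sliceIntegral : Integrable (sliceIntegral H a) := by
  have h := (integrable_expOrthant_sliceEquiv H a).integral_prod_right
  simp_rw [sliceEquiv_apply] at h
  exact h

/-- Dominated convergence: `expOrthant` can jump only on coordinate hyperplanes, and these meet H in
null sets. -/
theorem continuousAt_sliceIntegral_zero (hcoord : ∀ j, ∃ x ∈ H, x j ≠ 0) :
    ContinuousAt (sliceIntegral H a) 0 := by
  obtain ⟨g, hg, hbound⟩ := exists_integrable_bound_expOrthant_add H
  unfold sliceIntegral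
  have hA : Continuous fun y : EuclideanSpace ℝ (Fin m) =>
      (a.repr.symm y : EuclideanSpace ℝ (Fin N)) := by fun_prop
  refine continuousAt_of_dominated (bound := g) (Filter.Eventually.of_forall fun y => ?_) ?_ hg ?_
  · exact (Complex.measurable_ofReal.comp
      (measurable_expOrthant.comp (by fun_prop))).aestronglyMeasurable
  · filter_upwards [Metric.closedBall_mem_nhds (0 : EuclideanSpace ℝ (Fin m)) one_pos] with y hy
    refine Filter.Eventually.of_forall fun h => ?_
    rw [Complex.norm_real, Real.norm_of_nonneg (expOrthant_nonneg _)]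
    refine hbound h _ ?_
    rw [← Submodule.coe_norm, LinearIsometryEquiv.norm_map]
    simpa using hy
  · filter_upwards [ae_forall_coord_ne_zero H hcoord] with h hh
    refine Complex.continuous_ofReal.continuousAt.comp ?_
    refine ContinuousAt.comp (f := fun y : EuclideanSpace ℝ (Fin m) =>
      (h : EuclideanSpace ℝ (Fin N)) + (a.repr.symm y : EuclideanSpace ℝ (Fin N)))
      (continuousAt_expOrthant ?_) (continuous_const.add hA).continuousAt
    simpa using hh

/-- The frequency lies in Hᗮ, so the character is constant along slices and Fubini reduces the claim
to the transform of `expOrthant`. The factor 2π is the normalisation of `fourier`. -/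
theorem fourier_sliceIntegral (v : EuclideanSpace ℝ (Fin m)) :
    FourierTransform.fourier (sliceIntegral H a) v =
      ∏ j, 1 / (1 + Complex.I *
        (((a.repr.symm ((2 * Real.pi) • v) : EuclideanSpace ℝ (Fin N)) j : ℝ) : ℂ)) := by
  set z : EuclideanSpace ℝ (Fin N) := ↑(a.repr.symm ((2 * Real.pi) • v)) with hz
  have hinner : ∀ p : H × EuclideanSpace ℝ (Fin m),
      -(∑ j, z j * sliceEquiv H a p j) = -2 * Real.pi * inner ℝ p.2 v := by
    intro p
    have h1 : ∑ j, z j * sliceEquiv H a p j = inner ℝ (sliceEquiv H a p) z := by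
      rw [PiLp.inner_apply]
      rfl
    rw [h1, sliceEquiv_apply, inner_add_left, Submodule.inner_right_of_mem_orthogonal p.1.2
      (a.repr.symm ((2 * Real.pi) • v)).2, ← Submodule.coe_inner, LinearIsometryEquiv.inner_map_map,
      inner_smul_right]
    ring
  rw [← integral_cexp_mul_expOrthant,
    ← (measurePreserving_sliceEquiv H a).integral_comp (sliceEquiv H a).measurableEmbedding,
    Real.fourier_eq', Measure.volume_eq_prod, integral_prod_symm]
  · congr 1
    ext y
    rw [sliceIntegral, smul_eq_mul, ← integral_const_mul]
    congr 1
    ext h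
    rw [← Complex.ofReal_neg, hinner (h, y), sliceEquiv_apply]
  · refine (integrable_expOrthant_sliceEquiv H a).bdd_mul (c := 1) ?_
      (Filter.Eventually.of_forall fun p => ?_)
    · simp_rw [← Complex.ofReal_neg, hinner]
      exact Continuous.aestronglyMeasurable (by fun_prop)
    · rw [← Complex.ofReal_neg, Complex.norm_exp_ofReal_mul_I]

/-- Fourier inversion at the origin for the slice integrals. -/
theorem sliceIntegral_zero_eq (hcoord : ∀ j, ∃ x ∈ H, x j ≠ 0)
    (hint : Integrable (fun s : EuclideanSpace ℝ (Fin m) => ∏ j, 1 / (1 + Complex.I *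
      (((a.repr.symm s : EuclideanSpace ℝ (Fin N)) j : ℝ) : ℂ)))) :
    sliceIntegral H a 0 = 1 / (2 * (Real.pi : ℂ)) ^ m *
      ∫ s : EuclideanSpace ℝ (Fin m), ∏ j, 1 / (1 + Complex.I *
        (((a.repr.symm s : EuclideanSpace ℝ (Fin N)) j : ℝ) : ℂ)) := by
  have hF : FourierTransform.fourier (sliceIntegral H a) = _ := funext (fourier_sliceIntegral H a)
  have hpi : (2 * Real.pi) ≠ 0 := by positivity
  have hint' := (integrable_comp_smul_iff volume _ hpi).2 hint
  rw [← (integrable_sliceIntegral H a).fourierInv_fourier_eq (hF ▸ hint')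
    (continuousAt_sliceIntegral_zero H a hcoord), Real.fourierInv_eq, hF]
  simp only [inner_zero_right, AddChar.map_zero_eq_one, one_smul]
  -- The substitution s = 2πv produces the factor (2π)^(-m).
  rw [Measure.integral_comp_smul volume (fun s : EuclideanSpace ℝ (Fin m) =>
    ∏ j, 1 / (1 + Complex.I * (((a.repr.symm s : EuclideanSpace ℝ (Fin N)) j : ℝ) : ℂ))),
    finrank_euclideanSpace_fin, abs_of_pos (by positivity), Complex.real_smul]
  push_cast
  rw [one_div]

end Slices

/-! ### The exponential integral over the cone as the volume of its section. -/

section ConeVolume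

open scoped Pointwise

variable {N : ℕ} (H : Submodule ℝ (EuclideanSpace ℝ (Fin N)))

/-- The truncated cone of nonnegative vectors of `H` with coordinate sum at most `t`. -/
def truncatedCone (t : ℝ) : Set H :=
  {h | (∀ j, 0 ≤ (h : EuclideanSpace ℝ (Fin N)) j) ∧ ∑ j, (h : EuclideanSpace ℝ (Fin N)) j ≤ t}

/-- The nonnegative vectors of `H` with coordinate sum `t`. -/
def coneSection (t : ℝ) : Set H :=
  {h | (∀ j, 0 ≤ (h : EuclideanSpace ℝ (Fin N)) j) ∧ ∑ j, (h : EuclideanSpace ℝ (Fin N)) j = t}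

theorem truncatedCone_eq_smul {t : ℝ} (ht : 0 < t) :
    truncatedCone H t = t • truncatedCone H 1 := by
  ext h
  rw [Set.mem_smul_set_iff_inv_smul_mem₀ ht.ne']
  simp only [truncatedCone, Set.mem_ofPred_eq, Submodule.coe_smul, PiLp.smul_apply, smul_eq_mul,
    ← Finset.mul_sum, mul_nonneg_iff_of_pos_left (inv_pos.2 ht), inv_mul_le_iff₀ ht, mul_one]

theorem coneSection_eq_smul {t : ℝ} (ht : 0 < t) :
    coneSection H t = t • coneSection H 1 := by
  ext h
  rw [Set.mem_smul_set_iff_inv_smul_mem₀ ht.ne']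
  simp only [coneSection, Set.mem_ofPred_eq, Submodule.coe_smul, PiLp.smul_apply, smul_eq_mul,
    ← Finset.mul_sum, mul_nonneg_iff_of_pos_left (inv_pos.2 ht), inv_mul_eq_iff_eq_mul₀ ht.ne',
    mul_one]

theorem measurableSet_setOf_truncatedCone :
    MeasurableSet {p : H × ℝ | p.1 ∈ truncatedCone H p.2} := by
  refine IsClosed.measurableSet ?_
  have : {p : H × ℝ | p.1 ∈ truncatedCone H p.2} =
      (⋂ j, {p : H × ℝ | 0 ≤ (p.1 : EuclideanSpace ℝ (Fin N)) j}) ∩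
        {p : H × ℝ | ∑ j, (p.1 : EuclideanSpace ℝ (Fin N)) j ≤ p.2} := by
    ext p
    simp [truncatedCone]
  rw [this]
  exact (isClosed_iInter fun j => isClosed_le (by fun_prop) (by fun_prop)).inter
    (isClosed_le (by fun_prop) (by fun_prop))

theorem measurableSet_truncatedCone (t : ℝ) : MeasurableSet (truncatedCone H t) :=
  (measurableSet_setOf_truncatedCone H).preimage
    (by fun_prop : Measurable fun h : H => (h, t))

/-- Layer-cake representation of `expOrthant` on `H`. -/
theorem ofReal_expOrthant_eq_lintegral (h : H) :
    ENNReal.ofReal (expOrthant (h : EuclideanSpace ℝ (Fin N))) =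
      ∫⁻ t in Set.Ioi (0 : ℝ), (truncatedCone H t).indicator 1 h * ENNReal.ofReal (Real.exp (-t)) := by
  classical
  set σ : ℝ := ∑ j, (h : EuclideanSpace ℝ (Fin N)) j with hσ
  rw [expOrthant_eq_ite]
  split_ifs with hpos
  · have hσ0 : 0 ≤ σ := Finset.sum_nonneg fun j _ => hpos j
    have h1 : ∀ t, (truncatedCone H t).indicator (1 : H → ENNReal) h *
        ENNReal.ofReal (Real.exp (-t)) =
        (Set.Ici σ).indicator (fun t => ENNReal.ofReal (Real.exp (-t))) t := by
      intro t
      by_cases ht : σ ≤ t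
      · rw [Set.indicator_of_mem (show h ∈ truncatedCone H t from ⟨hpos, ht⟩),
          Set.indicator_of_mem (show t ∈ Set.Ici σ from ht)]
        simp
      · rw [Set.indicator_of_notMem (fun hh => ht hh.2), Set.indicator_of_notMem
          (show t ∉ Set.Ici σ from ht), zero_mul]
    have hset : (Set.Ici σ ∩ Set.Ioi 0 : Set ℝ) =ᵐ[volume] Set.Ioi σ := by
      have := (Ioi_ae_eq_Ici (μ := volume) (a := σ)).symm.inter
        (Filter.EventuallyEq.refl _ (Set.Ioi (0 : ℝ)))
      rwa [Set.inter_eq_left.2 (Set.Ioi_subset_Ioi hσ0)] at this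
    simp_rw [h1]
    rw [lintegral_indicator measurableSet_Ici, Measure.restrict_restrict measurableSet_Ici,
      setLIntegral_congr hset,
      ← ofReal_integral_eq_lintegral_ofReal (integrableOn_exp_neg_Ioi σ)
        (Filter.Eventually.of_forall fun t => (Real.exp_pos _).le), integral_exp_neg_Ioi]
  · have h1 : ∀ t, (truncatedCone H t).indicator (1 : H → ENNReal) h = 0 := fun t =>
      Set.indicator_of_notMem (fun hh => hpos hh.1) _
    simp [h1]

/-- The exponential integral over the nonnegative cone of `H` in terms of the volume of the
truncated cone. -/
theorem lintegral_expOrthant_eq_factorial_mul :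
    ∫⁻ h : H, ENNReal.ofReal (expOrthant (h : EuclideanSpace ℝ (Fin N))) =
      (Module.finrank ℝ H).factorial * volume (truncatedCone H 1) := by
  set k := Module.finrank ℝ H with hk
  simp_rw [ofReal_expOrthant_eq_lintegral]
  rw [lintegral_lintegral_swap]
  -- Scaling gives t^k; the exponent is written (k + 1) - 1 to match the integral for Γ(k + 1) = k!.
  · have h1 : ∀ t ∈ Set.Ioi (0 : ℝ), ∫⁻ h : H, (truncatedCone H t).indicator 1 h *
        ENNReal.ofReal (Real.exp (-t)) =
        ENNReal.ofReal (Real.exp (-t) * t ^ ((k + 1 : ℝ) - 1)) * volume (truncatedCone H 1) := by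
      intro t ht
      have ht0 : 0 < t := ht
      rw [lintegral_mul_const' _ _ ENNReal.ofReal_ne_top,
        lintegral_indicator_one (measurableSet_truncatedCone H t), truncatedCone_eq_smul H ht0,
        Measure.addHaar_smul, abs_of_pos (by positivity), ENNReal.ofReal_mul (Real.exp_pos _).le,
        add_sub_cancel_right, Real.rpow_natCast]
      ring
    rw [setLIntegral_congr_fun measurableSet_Ioi h1]
    rw [lintegral_mul_const _ (by fun_prop), ← ofReal_integral_eq_lintegral_ofReal
      (Real.GammaIntegral_convergent (by positivity))
      ((ae_restrict_iff' measurableSet_Ioi).2 (Filter.Eventually.of_forall fun t ht => by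
        have ht0 : 0 < t := ht
        positivity)), ← Real.Gamma_eq_integral (by positivity), Real.Gamma_nat_eq_factorial,
      ENNReal.ofReal_natCast]
  · refine Measurable.aemeasurable ?_
    refine Measurable.mul ?_ (by fun_prop)
    exact (measurable_const (a := (1 : ENNReal))).indicator (measurableSet_setOf_truncatedCone H)

/-- The vector of `H` representing the coordinate sum. -/
noncomputable def sumVector : H :=
  H.orthogonalProjectionOnto (WithLp.toLp 2 fun _ => (1 : ℝ))

theorem inner_sumVector (h : H) :
    inner ℝ (sumVector H) h = ∑ j, (h : EuclideanSpace ℝ (Fin N)) j := by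
  rw [sumVector, Submodule.inner_orthogonalProjectionOnto_eq_of_mem_right, PiLp.inner_apply]
  simp

/-- The volume of the truncated cone by slicing. -/
theorem volume_truncatedCone_eq {r : ℕ} (hr : Module.finrank ℝ H = r + 1)
    (hq : sumVector H ≠ 0) :
    volume (truncatedCone H 1) =
      ENNReal.ofReal (1 / ((r + 1) * ‖sumVector H‖)) * μHE[r] (coneSection H 1) := by
  set q := sumVector H with hqdef
  have hd : 0 < ‖q‖ := norm_pos_iff.2 hq
  -- Since q represents the coordinate sum, the hyperplane through x • q orthogonal to q is the
  -- level set at x‖q‖².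
  have hslice : ∀ x : ℝ, truncatedCone H 1 ∩ (AffineSubspace.mk' (x • q +ᵥ (0 : H)) (ℝ ∙ q)ᗮ : Set H)
      = if x * ‖q‖ ^ 2 ≤ 1 then coneSection H (x * ‖q‖ ^ 2) else ∅ := by
    intro x
    have hmem : ∀ h : H, h ∈ AffineSubspace.mk' (x • q +ᵥ (0 : H)) (ℝ ∙ q)ᗮ ↔
        ∑ j, (h : EuclideanSpace ℝ (Fin N)) j = x * ‖q‖ ^ 2 := by
      intro h
      rw [AffineSubspace.mem_mk', vadd_eq_add, add_zero, vsub_eq_sub,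
        Submodule.mem_orthogonal_singleton_iff_inner_right, inner_sub_right,
        show inner ℝ q (x • q) = x * inner ℝ q q from real_inner_smul_right q q x,
        real_inner_self_eq_norm_sq, inner_sumVector, sub_eq_zero]
    ext h
    rw [Set.mem_inter_iff, SetLike.mem_coe, hmem]
    split_ifs with hx
    · exact ⟨fun hh => ⟨hh.1.1, hh.2⟩, fun hh => ⟨⟨hh.1, hh.2.trans_le hx⟩, hh.2⟩⟩
    · exact ⟨fun hh => hx (hh.2 ▸ hh.1.2), fun hh => hh.elim⟩
  have hvol : ∀ x : ℝ, x ≠ 0 → μHE[r] (truncatedCone H 1 ∩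
      (AffineSubspace.mk' (x • q +ᵥ (0 : H)) (ℝ ∙ q)ᗮ : Set H)) =
      (Set.Ioc 0 (1 / ‖q‖ ^ 2)).indicator (fun x => ENNReal.ofReal ((x * ‖q‖ ^ 2) ^ r) *
        μHE[r] (coneSection H 1)) x := by
    intro x hx
    rw [hslice]
    rcases lt_or_gt_of_ne hx with hneg | hpos
    · rw [Set.indicator_of_notMem (fun h => hneg.not_gt h.1)]
      have : coneSection H (x * ‖q‖ ^ 2) = ∅ := by
        refine Set.eq_empty_of_forall_notMem fun h hh => ?_
        have h0 : 0 ≤ ∑ j, (h : EuclideanSpace ℝ (Fin N)) j := Finset.sum_nonneg fun j _ => hh.1 j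
        rw [hh.2] at h0
        exact absurd (mul_neg_of_neg_of_pos hneg (pow_pos hd 2)) h0.not_gt
      rw [this, ite_self, measure_empty]
    · have hy : 0 < x * ‖q‖ ^ 2 := by positivity
      by_cases hx1 : x * ‖q‖ ^ 2 ≤ 1
      · rw [if_pos hx1, Set.indicator_of_mem (show x ∈ Set.Ioc 0 (1 / ‖q‖ ^ 2) from
          ⟨hpos, (le_div_iff₀ (pow_pos hd 2)).2 hx1⟩), coneSection_eq_smul H hy,
          Measure.euclideanHausdorffMeasure_smul₀ r hy.ne', ENNReal.ofReal_pow hy.le,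
          ENNReal.smul_def, smul_eq_mul, ENNReal.coe_pow, ← enorm_eq_nnnorm,
          Real.enorm_of_nonneg hy.le]
      · rw [if_neg hx1, Set.indicator_of_notMem (fun h => hx1 ((le_div_iff₀ (pow_pos hd 2)).1 h.2)),
          measure_empty]
  -- The homogeneity of the sections is available only at positive levels, so x = 0 is discarded.
  have hae : ∀ᵐ x : ℝ, x ≠ 0 := by simp [ae_iff]
  rw [← InnerProductSpace.euclideanHausdorffMeasure_eq_volume,
    EuclideanGeometry.euclideanHausdorffMeasure_eq_lintegral (0 : H) hq
      (measurableSet_truncatedCone H 1), hr, Nat.add_sub_cancel,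
    lintegral_congr_ae (hae.mono fun x hx => hvol x hx), lintegral_indicator measurableSet_Ioc,
    lintegral_mul_const _ (by fun_prop), ← mul_assoc]
  congr 1
  -- Used with D = ‖q‖²; the slicing parameter x ↦ x • q has speed ‖q‖, which leaves 1 / ((r +
  -- 1)‖q‖).
  have hint : ∀ D : ℝ, 0 < D → ∫ x in Set.Ioc 0 (1 / D), (x * D) ^ r = 1 / D / (r + 1) := by
    intro D hD
    rw [← intervalIntegral.integral_of_le (by positivity)]
    simp_rw [mul_pow]
    rw [intervalIntegral.integral_mul_const, integral_pow, zero_pow (Nat.succ_ne_zero r), sub_zero,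
      div_pow, one_pow, pow_succ]
    field_simp
  rw [← ofReal_integral_eq_lintegral_ofReal, hint _ (pow_pos hd 2), ← ofReal_norm,
    ← ENNReal.ofReal_mul hd.le]
  · congr 1
    field_simp
  · exact (Continuous.integrableOn_Icc (by fun_prop)).mono_set Set.Ioc_subset_Icc_self
  · refine (ae_restrict_iff' measurableSet_Ioc).2 (Filter.Eventually.of_forall fun x hx => ?_)
    have := hx.1
    positivity

/-- The exponential integral over the nonnegative cone of `H` in terms of its section. -/
theorem lintegral_expOrthant_eq {r : ℕ} (hr : Module.finrank ℝ H = r + 1)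
    (hq : sumVector H ≠ 0) :
    ∫⁻ h : H, ENNReal.ofReal (expOrthant (h : EuclideanSpace ℝ (Fin N))) =
      ENNReal.ofReal (r.factorial / ‖sumVector H‖) * μHE[r] (coneSection H 1) := by
  have hd : 0 < ‖sumVector H‖ := norm_pos_iff.2 hq
  rw [lintegral_expOrthant_eq_factorial_mul, volume_truncatedCone_eq H hr hq, hr, ← mul_assoc,
    ← ENNReal.ofReal_natCast, ← ENNReal.ofReal_mul (by positivity), Nat.factorial_succ]
  congr 2
  push_cast
  field_simp

theorem integrable_expOrthant_coe :
    Integrable (fun h : H => expOrthant (h : EuclideanSpace ℝ (Fin N))) := by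
  obtain ⟨g, hg, hbound⟩ := exists_integrable_bound_expOrthant_add H
  refine hg.mono' (measurable_expOrthant.comp measurable_subtype_coe).aestronglyMeasurable
    (Filter.Eventually.of_forall fun h => ?_)
  rw [Real.norm_of_nonneg (expOrthant_nonneg _)]
  simpa using hbound h 0 (by simp)

/-- The square of the norm of the representing vector of the coordinate sum. -/
theorem norm_sumVector_sq {m : ℕ} (a : OrthonormalBasis (Fin m) ℝ Hᗮ) :
    ‖sumVector H‖ ^ 2 = N - ∑ l, (∑ j, (a l : EuclideanSpace ℝ (Fin N)) j) ^ 2 := by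
  set u : EuclideanSpace ℝ (Fin N) := WithLp.toLp 2 fun _ => (1 : ℝ) with hu
  have h1 : ‖u‖ ^ 2 = N := by
    rw [EuclideanSpace.norm_sq_eq]
    simp [hu]
  have h2 : ‖Hᗮ.orthogonalProjectionOnto u‖ ^ 2 =
      ∑ l, (∑ j, (a l : EuclideanSpace ℝ (Fin N)) j) ^ 2 := by
    rw [← a.sum_sq_norm_inner_right]
    refine Finset.sum_congr rfl fun l _ => ?_
    rw [Submodule.inner_orthogonalProjectionOnto_eq_of_mem_left, PiLp.inner_apply]
    simp [hu]
  have h3 := Submodule.norm_sq_eq_add_norm_sq_projection u H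
  rw [sumVector, ← h2, ← h1]
  linarith

end ConeVolume

/-! ### The simplex section and the volume formula. -/

/-- The intersection of `H` with the simplex, as the image of the section of its cone. -/
theorem image_coneSection_one {n : ℕ} (H : Submodule ℝ (EuclideanSpace ℝ (Fin (n + 1)))) :
    (H : Set (EuclideanSpace ℝ (Fin (n + 1)))) ∩ regularSimplex n =
      Subtype.val '' coneSection H 1 := by
  ext x
  constructor
  · rintro ⟨hx, hs, hp⟩
    exact ⟨⟨x, hx⟩, ⟨hp, hs⟩, rfl⟩
  · rintro ⟨h, ⟨hp, hs⟩, rfl⟩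
    exact ⟨h.2, hs, hp⟩

/-- The integrand in terms of the linear map `s ↦ ∑ l, s l • a l`. -/
theorem sectionIntegrand_eq {n m : ℕ} {K : Submodule ℝ (EuclideanSpace ℝ (Fin (n + 1)))}
    (a : OrthonormalBasis (Fin m) ℝ K) (s : EuclideanSpace ℝ (Fin m)) :
    sectionIntegrand (fun l => (a l : EuclideanSpace ℝ (Fin (n + 1)))) s =
      ∏ j, 1 / (1 + Complex.I *
        (((a.repr.symm s : EuclideanSpace ℝ (Fin (n + 1))) j : ℝ) : ℂ)) := by
  unfold sectionIntegrand
  refine Finset.prod_congr rfl fun j _ => ?_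
  rw [← a.sum_repr_symm s]
  simp [mul_comm]

/-- Integrability of the section integrand. -/
theorem integrable_sectionIntegrand {n m : ℕ} (H : Submodule ℝ (EuclideanSpace ℝ (Fin (n + 1))))
    (hcoord : ∀ j, ∃ x ∈ H, x j ≠ 0) (a : OrthonormalBasis (Fin m) ℝ Hᗮ) :
    Integrable (sectionIntegrand fun l => (a l : EuclideanSpace ℝ (Fin (n + 1)))) := by
  simp_rw [funext (sectionIntegrand_eq a)]
  let A : EuclideanSpace ℝ (Fin m) →ₗ[ℝ] (Fin (n + 1) → ℝ) :=
    (WithLp.linearEquiv 2 ℝ (Fin (n + 1) → ℝ)).toLinearMap ∘ₗ Hᗮ.subtype ∘ₗ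
      a.repr.symm.toLinearEquiv.toLinearMap
  refine integrable_prod_one_div_one_add_I_mul n.succ_pos A fun i s hs => ?_
  obtain ⟨x, hx, hxi⟩ := hcoord i
  set y : EuclideanSpace ℝ (Fin (n + 1)) := ↑(a.repr.symm s) with hy
  have hs' : ∀ j, j ≠ i → y j = 0 := hs
  -- With y supported at i, orthogonality to x reads x_i y_i = 0, and x_i ≠ 0.
  have h0 : inner ℝ x y = 0 :=
    Submodule.inner_right_of_mem_orthogonal hx (a.repr.symm s).2
  rw [PiLp.inner_apply, Finset.sum_eq_single i (fun j _ hj => by simp [hs' j hj]) (by simp)] at h0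
  have hyi : y i = 0 := by simpa [hxi] using h0
  have hy0 : y = 0 := by
    ext j
    by_cases hj : j = i
    · rw [hj, hyi]; rfl
    · exact hs' j hj
  have : a.repr.symm s = 0 := Subtype.ext hy0
  simpa using this


/-- The `(k-1)`-volume of the section is measured by `μHE[k - 1]`, the Hausdorff measure normalised so
that it agrees with the induced Lebesgue measure on every `(k-1)`-dimensional affine subspace. -/
theorem theorem1 (n k : ℕ) (hk : 1 ≤ k)
    (H : Submodule ℝ (EuclideanSpace ℝ (Fin (n + 1))))
    (hH : Module.finrank ℝ H = k)
    (hcoord : ∀ j : Fin (n + 1), ∃ x ∈ H, x j ≠ 0)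
    (a : OrthonormalBasis (Fin (n + 1 - k)) ℝ Hᗮ) :
    Integrable (sectionIntegrand fun l => (a l : EuclideanSpace ℝ (Fin (n + 1)))) ∧
    μHE[k - 1] ((H : Set (EuclideanSpace ℝ (Fin (n + 1)))) ∩ regularSimplex n) < ⊤ ∧
    ((μHE[k - 1].real ((H : Set (EuclideanSpace ℝ (Fin (n + 1)))) ∩ regularSimplex n) : ℝ) : ℂ) =
      ((Real.sqrt ((n : ℝ) + 1 -
          ∑ l, (∑ j, (a l : EuclideanSpace ℝ (Fin (n + 1))) j) ^ 2) / (k - 1).factorial : ℝ) : ℂ) *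
        (1 / (2 * (Real.pi : ℂ)) ^ (n + 1 - k)) *
        ∫ s : EuclideanSpace ℝ (Fin (n + 1 - k)),
          sectionIntegrand (fun l => (a l : EuclideanSpace ℝ (Fin (n + 1)))) s := by

  have hint := integrable_sectionIntegrand H hcoord a
  obtain ⟨r, rfl⟩ : ∃ r, k = r + 1 := ⟨k - 1, by omega⟩
  rw [Nat.add_sub_cancel]
  set V := μHE[r] (coneSection H 1) with hV
  have hvol : μHE[r] ((H : Set (EuclideanSpace ℝ (Fin (n + 1)))) ∩ regularSimplex n) = V := by
    rw [image_coneSection_one]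
    exact isometry_subtype_coe.euclideanHausdorffMeasure_image _
  have hnorm : Real.sqrt ((n : ℝ) + 1 -
      ∑ l, (∑ j, (a l : EuclideanSpace ℝ (Fin (n + 1))) j) ^ 2) = ‖sumVector H‖ := by
    have h := norm_sumVector_sq H a
    push_cast at h
    rw [← h, Real.sqrt_sq (norm_nonneg _)]
  rw [measureReal_def, hvol, hnorm]
  refine ⟨hint, ?_⟩
  -- If q = 0 the coordinate sum vanishes on H: the section is empty and the square root is 0.
  by_cases hq : sumVector H = 0
  · have hempty : coneSection H 1 = ∅ := by
      refine Set.eq_empty_of_forall_notMem fun h hh => ?_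
      have h1 := inner_sumVector H h
      rw [hq, inner_zero_left, hh.2] at h1
      exact zero_ne_one h1
    simp [hV, hempty, hq]
  · have hd : 0 < ‖sumVector H‖ := norm_pos_iff.2 hq
    have hc : 0 < (r.factorial : ℝ) / ‖sumVector H‖ := by positivity
    have hlint := lintegral_expOrthant_eq H hH hq
    rw [← hV, ← ofReal_integral_eq_lintegral_ofReal (integrable_expOrthant_coe H)
      (Filter.Eventually.of_forall fun _ => expOrthant_nonneg _)] at hlint
    -- The exponential integral is finite and equals a positive multiple of `V`.
    have hfin : V < ⊤ := by
      refine lt_top_iff_ne_top.2 fun htop => ?_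
      rw [htop, ENNReal.mul_top (ENNReal.ofReal_pos.2 hc).ne'] at hlint
      exact ENNReal.ofReal_ne_top hlint
    refine ⟨hfin, ?_⟩
    have hreal := congrArg ENNReal.toReal hlint
    rw [ENNReal.toReal_ofReal (integral_nonneg fun _ => expOrthant_nonneg _), ENNReal.toReal_mul,
      ENNReal.toReal_ofReal hc.le] at hreal
    have hint' := hint
    simp_rw [funext (sectionIntegrand_eq a)] at hint' ⊢
    rw [mul_assoc, ← sliceIntegral_zero_eq H a hcoord hint', sliceIntegral]
    simp only [map_zero, Submodule.coe_zero, add_zero]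
    rw [integral_complex_ofReal, hreal, ← Complex.ofReal_mul]
    congr 1
    have : (r.factorial : ℝ) ≠ 0 := by positivity
    field_simp
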